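/- Let $A=(a_1,\dots,a_n)$ be a configuration of points of $\mathbb{R}^d$ (repetitions and affine dependencies allowed) whose affine span is $\mathbb{R}^d$, and put $v_i=(a_i,1)\in\mathbb{R}^{d+1}$. For disjoint $I,B\subseteq\{1,\dots,n\}$ with $(a_b)_{b\in B}$ affinely independent let $\Pi_{I,B}=\sum_{i\in I}v_i+\sum_{b\in B}[0,v_b]$; if $|B|=d+1$ call $|I|$ its order and say that it is supported on $x\in\mathbb{R}^d$ if $x\in\operatorname{conv}\{a_i : i\in I\sqcup B\}$. Let $h$ assign a real height $h_i$ to each index $i$, and assume that $h$ is generic: any $d+2$ of the points $(a_i,h_i)\in\mathbb{R}^{d+1}$ that are affinely dependent lie on a common hyperplane whose normal vector has last coordinate zero. Let $\mathcal{P}(h)$ be the associated regular fine zonotopal tiling of $\sum_{i=1}^n[0,v_i]$: its tiles are the $\Pi_{I,B}$ with $|B|=d+1$ for which $\sum_{i\in I}\tilde v_i+\sum_{b\in B}[0,\tilde v_b]$, where $\tilde v_i=(a_i,h_i,1)$, is a face of the zonotope $\sum_{i=1}^n[0,\tilde v_i]\subset\mathbb{R}^{d+2}$ having an outward normal vector with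 positive $(d+1)$-th coordinate. The facets of a tile $\Pi_{I,B}$ are the parallelepipeds $\Pi_{J,C}$ with $C=B\setminus\{b\}$ and $J=I$ or $J=I\sqcup\{b\}$, for some $b\in B$. A facet is internal if it is shared by two distinct tiles. Let $x\in\operatorname{conv}\{a_1,\dots,a_n\}$ be generic, i.e. $x\notin\operatorname{aff}\{a_c : c\in C\}$ for every internal facet $\Pi_{J,C}$ of $\mathcal{P}(h)$. The $x$-oriented adjacency graph has the tiles as vertices and, for each internal facet $\Pi_{J,C}$, an edge between the two tiles sharing it; with $N\ne 0$ a normal vector of the facet (so $\langle N,v_c\rangle=0$ for $c\in C$), the edge is directed $\Pi\to\Pi'$ if $\operatorname{sign}\langle N,(x,1)\rangle=\operatorname{sign}\langle N,z'-z\rangle$ for all interior points $z$ of $\Pi$ and $z'$ of $\Pi'$. Then there is exactly one tile $\Pi_{\varnothing,Z}$ of order $0$ in $\mathcal{P}(h)$ supported on $x$, and for every tile $\Pi_{I',B'}\in\mathcal{P}(h)$ supported on $x$ there is a directed path in the $x$-oriented adjacency graph from $\Pi_{\varnothing,Z}$ to $\Pi_{I',B'}$ such that every tile on the path is supported on $x$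 and has order at most $|I'|$. -/

import Mathlib

open scoped Matrix

noncomputable section

/-- The vector `(a, 1) ∈ ℝ^(m+1)` obtained from `a ∈ ℝ^m`. -/
def projLift {m : ℕ} (p : Fin m → ℝ) : Fin (m + 1) → ℝ :=
  Fin.snoc (α := fun _ => ℝ) p 1

/-- The point `(a_i, h_i) ∈ ℝ^(d+1)` over `a_i`. Heights are attached to indices, so that
repeated points of the configuration may have different heights. -/
def heightLift {n d : ℕ} (a : Fin n → Fin d → ℝ) (h : Fin n → ℝ) (i : Fin n) :
    Fin (d + 1) → ℝ :=
  Fin.snoc (α := fun _ => ℝ) (a i) (h i)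

/-- The height function `h` is generic: any `d + 2` of the lifted points `(a_i, h_i)` that are
affinely dependent lie on a vertical hyperplane of `ℝ^(d+1)`, that is, on a hyperplane whose
normal vector `N` has last coordinate zero. -/
def IsGenericHeight {n d : ℕ} (a : Fin n → Fin d → ℝ) (h : Fin n → ℝ) : Prop :=
  ∀ S : Finset (Fin n), S.card = d + 2 →
    ¬ AffineIndependent ℝ (fun i : S => heightLift a h i) →
    ∃ N : Fin (d + 1) → ℝ, N ≠ 0 ∧ N (Fin.last d) = 0 ∧
      ∃ c : ℝ, ∀ i ∈ S, N ⬝ᵥ heightLift a h i = c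

/-- The zonotope of a vector configuration: the Minkowski sum of the segments `[0, v_i]`. -/
def zonotope {n m : ℕ} (v : Fin n → Fin m → ℝ) : Set (Fin m → ℝ) :=
  {z | ∃ α : Fin n → ℝ, (∀ i, 0 ≤ α i ∧ α i ≤ 1) ∧ z = ∑ i, α i • v i}

/-- Index data `(I, B)`, with `I` and `B` disjoint, of a parallelepiped `Π_{I,B}`. -/
structure Cell (n : ℕ) where
  /-- the set `I` -/
  base : Finset (Fin n)
  /-- the set `B` -/
  dirs : Finset (Fin n)
  disj : Disjoint base dirs

/-- The order `|I|` of `Π_{I,B}`. -/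
def Cell.order {n : ℕ} (T : Cell n) : ℕ := T.base.card

/-- The parallelepiped `Π_{I,B} = ∑_{i ∈ I} v_i + ∑_{b ∈ B} [0, v_b]`. -/
def Cell.toSet {n m : ℕ} (T : Cell n) (v : Fin n → Fin m → ℝ) : Set (Fin m → ℝ) :=
  {z | ∃ α : Fin n → ℝ, (∀ b ∈ T.dirs, 0 ≤ α b ∧ α b ≤ 1) ∧
    z = ∑ i ∈ T.base, v i + ∑ b ∈ T.dirs, α b • v b}

/-- `F` is a face of `Z ⊆ ℝ^(d+2)` with an outward normal vector `y` whose `(d+1)`-th coordinate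
(the height coordinate, the last but one) is positive: `F` is the set of points of `Z` at which
the linear functional `⟨·, y⟩` is maximal. -/
def IsUpperFace {d : ℕ} (Z F : Set (Fin (d + 2) → ℝ)) : Prop :=
  ∃ y : Fin (d + 2) → ℝ, 0 < y (Fin.last d).castSucc ∧
    F = {z | z ∈ Z ∧ ∀ w ∈ Z, w ⬝ᵥ y ≤ z ⬝ᵥ y}

/-- The regular tiling `𝒫(h)`: the (full-dimensional) parallelepipeds `Π_{I,B}` that are the
projections of the faces `Π̃_{I,B}` in the upper convex hull of the zonotope built on the vectors
`(a_i, h_i, 1)`. -/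
def regularTiling {n d : ℕ} (a : Fin n → Fin d → ℝ) (h : Fin n → ℝ) : Set (Cell n) :=
  {T | T.dirs.card = d + 1 ∧ AffineIndependent ℝ (fun b : T.dirs => a b) ∧
    IsUpperFace (zonotope fun i => projLift (heightLift a h i))
      (T.toSet fun i => projLift (heightLift a h i))}

/-- `Π_{J,C} = F` is a facet of `Π_{I,B} = T`: for one `b ∈ B` the coefficient of `v_b` is set to
`0` (then `J = I`) or to `1` (then `J = I ⊔ {b}`), and `C = B \ {b}`. -/
def Cell.IsFacetOf {n : ℕ} (F T : Cell n) : Prop :=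
  ∃ b ∈ T.dirs, F.dirs = T.dirs.erase b ∧ (F.base = T.base ∨ F.base = insert b T.base)

/-- `F` is a facet shared by the two distinct tiles `T` and `T'` of `P`. -/
def IsSharedFacet {n : ℕ} (P : Set (Cell n)) (F T T' : Cell n) : Prop :=
  T ∈ P ∧ T' ∈ P ∧ T ≠ T' ∧ F.IsFacetOf T ∧ F.IsFacetOf T'

/-- The tile `Π_{I,B}` (with its spline) is supported on `x`: `x ∈ ch({a_i}_{i ∈ I ⊔ B})`. -/
def Cell.SupportedOn {n d : ℕ} (a : Fin n → Fin d → ℝ) (T : Cell n) (x : Fin d → ℝ) : Prop :=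
  x ∈ convexHull ℝ (a '' ((T.base ∪ T.dirs : Finset (Fin n)) : Set (Fin n)))

/-- `x` is generic with respect to `P`: it lies on no affine span `aff({a_c}_{c ∈ C})` for an
internal facet `Π_{J,C}` of `P`. -/
def IsGenericForTiling {n d : ℕ} (a : Fin n → Fin d → ℝ) (P : Set (Cell n)) (x : Fin d → ℝ) : Prop :=
  ∀ F T T' : Cell n, IsSharedFacet P F T T' →
    x ∉ affineSpan ℝ (a '' (F.dirs : Set (Fin n)))

/-- The adjacency graph of `P` with the orientation induced by `x`. There is an edge `T → T'` if
the tiles share a facet `Π_{J,C}` and `sign ⟨N, (x,1)⟩ = sign ⟨N, z' - z⟩` for the normal vectors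
`N` of that facet and all points `z`, `z'` in the interior of `T`, `T'`. -/
def orientedAdjacencyGraph {n d : ℕ} (a : Fin n → Fin d → ℝ) (P : Set (Cell n))
    (x : Fin d → ℝ) : Digraph (Cell n) where
  Adj T T' := ∃ F : Cell n, IsSharedFacet P F T T' ∧
    ∀ N : Fin (d + 1) → ℝ, N ≠ 0 → (∀ c ∈ F.dirs, N ⬝ᵥ projLift (a c) = 0) →
      ∀ z ∈ interior (T.toSet fun i => projLift (a i)),
        ∀ z' ∈ interior (T'.toSet fun i => projLift (a i)),
          SignType.sign (N ⬝ᵥ projLift x) = SignType.sign (N ⬝ᵥ (z' - z))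

/-- The list `p` is a directed path (without repeated vertices) from `s` to `t` in `G`. -/
def IsDirectedPath {V : Type*} (G : Digraph V) (s t : V) (p : List V) : Prop :=
  p.IsChain G.Adj ∧ p.Nodup ∧ p.head? = some s ∧ p.getLast? = some t

end

/-! A tile is encoded by a linear functional `c` on `ℝ^(d+1)`, i.e. an affine function on `ℝ^d`: it
interpolates the heights on `dirs`, lies strictly below them on `base` and strictly above them
elsewhere (`IsHeightCell`). The lemmas `exists_isHeightCell_of_mem_regularTiling` and
`IsHeightCell.mem_regularTiling` show that these are exactly the tiles of the regular tiling.
Genericity of `h` says that no further index is ever interpolated.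

The path is built backwards by simplex-type pivots, with the value of `c` at `(x, 1)` as potential.
Let a tile `(I, B)` of positive order be supported on `x`. Some `b ∈ B` has a positive coordinate of
`(x, 1)` in the basis of `B`, while `x` stays in the hull of `I ∪ B \ {b}`
(`exists_removable_direction`). Tilt `c` about the points of `B \ {b}`, upwards at `x`, until it
meets the next height `b'`. Some point of `I` lies on the side of `x`, so the tilting stops. The new
tile has `B' = B \ {b} ∪ {b'}` and `I' = I \ {b'}`: it is still supported on `x`, its order has not
grown, its potential is strictly larger, and its edge points to the old tile (`exists_predecessor`,
`adj_of_pivot`). There are finitely many cells, so the process ends at order `0`.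

Order `0` means that `c` dominates all heights. Two such functions supported on `x` agree at `x`,
and genericity of `x` then forces the tiles to coincide (`eq_of_order_zero`). -/

noncomputable section

/-! ### Homogenization of points -/

section ProjLift

variable {n m : ℕ}

@[simp] lemma projLift_castSucc (p : Fin m → ℝ) (k : Fin m) : projLift p k.castSucc = p k := by
  simp [projLift]

@[simp] lemma projLift_last (p : Fin m → ℝ) : projLift p (Fin.last m) = 1 := by
  simp [projLift]

lemma sum_smul_projLift {ι : Type*} (s : Finset ι) (w : ι → ℝ) (p : ι → Fin m → ℝ)
    (q : Fin m → ℝ) :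
    ∑ i ∈ s, w i • projLift (p i) = projLift q ↔ ∑ i ∈ s, w i = 1 ∧ ∑ i ∈ s, w i • p i = q := by
  rw [funext_iff, Fin.forall_fin_succ', and_comm]
  refine and_congr ?_ ?_
  · simp [Finset.sum_apply]
  · rw [funext_iff]
    simp [Finset.sum_apply]

lemma sum_smul_projLift_eq_zero {ι : Type*} (s : Finset ι) (w : ι → ℝ) (p : ι → Fin m → ℝ) :
    ∑ i ∈ s, w i • projLift (p i) = 0 ↔ ∑ i ∈ s, w i = 0 ∧ ∑ i ∈ s, w i • p i = 0 := by
  rw [funext_iff, Fin.forall_fin_succ', and_comm]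
  refine and_congr ?_ ?_
  · simp [Finset.sum_apply]
  · rw [funext_iff]
    simp [Finset.sum_apply]

lemma affineIndependent_iff_linearIndependent_projLift {ι : Type*} (p : ι → Fin m → ℝ) :
    AffineIndependent ℝ p ↔ LinearIndependent ℝ fun i => projLift (p i) := by
  rw [affineIndependent_iff, linearIndependent_iff']
  refine forall₂_congr fun s w => ?_
  rw [sum_smul_projLift_eq_zero]
  tauto

lemma affineIndependent_iff_linearIndepOn_projLift (p : Fin n → Fin m → ℝ) (B : Finset (Fin n)) :
    AffineIndependent ℝ (fun b : B => p b) ↔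
      LinearIndepOn ℝ (fun i => projLift (p i)) (B : Set (Fin n)) :=
  affineIndependent_iff_linearIndependent_projLift _

/-- Weights live on indices rather than points, so repeated points keep separate coefficients and
relations can be added coordinatewise. -/
lemma mem_convexHull_image_iff (a : Fin n → Fin m → ℝ) (S : Finset (Fin n)) (x : Fin m → ℝ) :
    x ∈ convexHull ℝ (a '' (S : Set (Fin n))) ↔
      ∃ μ : Fin n → ℝ, (∀ i, 0 ≤ μ i) ∧ (∀ i ∉ S, μ i = 0) ∧
        ∑ i, μ i • projLift (a i) = projLift x := by
  classical
  constructor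
  · intro hx
    refine convexHull_min (t := {x | ∃ μ : Fin n → ℝ, (∀ i, 0 ≤ μ i) ∧ (∀ i ∉ S, μ i = 0) ∧
        ∑ i, μ i • projLift (a i) = projLift x}) ?_ ?_ hx
    · rintro _ ⟨j, hj, rfl⟩
      refine ⟨Pi.single j 1, fun i => ?_, fun i hi => ?_, ?_⟩
      · by_cases h : i = j
        · subst h; simp
        · simp [h]
      · have : i ≠ j := by rintro rfl; exact hi hj
        simp [this]
      · simp [Pi.single_apply, ite_smul]
    · rintro y ⟨μ, h1, h2, h3⟩ z ⟨ν, k1, k2, k3⟩ s t hs ht hst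
      refine ⟨fun i => s * μ i + t * ν i, fun i => ?_, fun i hi => ?_, ?_⟩
      · have := h1 i; have := k1 i; positivity
      · simp [h2 i hi, k2 i hi]
      · rw [sum_smul_projLift] at *
        constructor
        · rw [Finset.sum_add_distrib, ← Finset.mul_sum, ← Finset.mul_sum, h3.1, k3.1]; linarith
        · simp only [add_smul, mul_smul]
          rw [Finset.sum_add_distrib, ← Finset.smul_sum, ← Finset.smul_sum, h3.2, k3.2]
  · rintro ⟨μ, h1, h2, h3⟩
    rw [← Finset.sum_subset (Finset.subset_univ S) (fun i _ hi => by simp [h2 i hi]),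
      sum_smul_projLift] at h3
    rw [← h3.2]
    exact (convex_convexHull ℝ _).sum_mem (fun i _ => h1 i) h3.1
      fun i hi => subset_convexHull ℝ _ ⟨i, hi, rfl⟩

end ProjLift

/-! ### Bases of `ℝ^m` indexed by finite sets -/

section Bases

variable {n m : ℕ} {v : Fin n → Fin m → ℝ} {B : Finset (Fin n)}

lemma span_image_eq_top_of_card_eq (hc : B.card = m) (hB : LinearIndepOn ℝ v (B : Set (Fin n))) :
    Submodule.span ℝ (v '' (B : Set (Fin n))) = ⊤ := by
  have h := LinearIndependent.span_eq_top_of_card_eq_finrank' (K := ℝ) (b := fun b : B => v b) hB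
    (by simpa using hc)
  rw [← h]
  congr 1
  ext y
  simp

lemma exists_sum_smul_eq (hc : B.card = m) (hB : LinearIndepOn ℝ v (B : Set (Fin n)))
    (u : Fin m → ℝ) : ∃ l : Fin n → ℝ, ∑ b ∈ B, l b • v b = u := by
  have h : u ∈ Submodule.span ℝ (v '' (B : Set (Fin n))) := by
    rw [span_image_eq_top_of_card_eq hc hB]; trivial
  exact (Submodule.mem_span_image_finset_iff_exists_fun' ℝ).1 h

lemma eq_of_dotProduct_eq_on (hc : B.card = m) (hB : LinearIndepOn ℝ v (B : Set (Fin n)))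
    {c c' : Fin m → ℝ} (h : ∀ b ∈ B, c ⬝ᵥ v b = c' ⬝ᵥ v b) : c = c' := by
  rw [← sub_eq_zero, ← dotProduct_self_eq_zero]
  obtain ⟨l, hl⟩ := exists_sum_smul_eq hc hB (c - c')
  nth_rewrite 2 [← hl]
  rw [dotProduct_sum]
  refine Finset.sum_eq_zero fun b hb => ?_
  rw [dotProduct_smul, sub_dotProduct, h b hb]
  simp

lemma exists_dotProduct_eq_on (hc : B.card = m) (hB : LinearIndepOn ℝ v (B : Set (Fin n)))
    (f : Fin n → ℝ) : ∃ c : Fin m → ℝ, ∀ b ∈ B, c ⬝ᵥ v b = f b := by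
  let φ : (Fin m → ℝ) →ₗ[ℝ] (B → ℝ) := LinearMap.pi fun b : B =>
    (dotProductBilin ℝ ℝ ).flip (v b)
  have hφ : Function.Injective φ := by
    intro c c' h
    refine eq_of_dotProduct_eq_on hc hB fun b hb => ?_
    exact congrFun h ⟨b, hb⟩
  have hs : Function.Surjective φ :=
    (LinearMap.injective_iff_surjective_of_finrank_eq_finrank (by simp [hc])).1 hφ
  obtain ⟨c, h⟩ := hs fun b => f b
  exact ⟨c, fun b hb => congrFun h ⟨b, hb⟩⟩

/-- Basis exchange: pairing a relation with `N` kills the coefficient of `b'`, and what remains is a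
relation inside `B`. -/
lemma linearIndepOn_insert_erase {b b' : Fin n} {N : Fin m → ℝ}
    (hB : LinearIndepOn ℝ v (B : Set (Fin n))) (hb' : b' ∉ B)
    (hN : ∀ c ∈ B.erase b, N ⬝ᵥ v c = 0) (hNb : N ⬝ᵥ v b' ≠ 0) :
    LinearIndepOn ℝ v ((insert b' (B.erase b) : Finset (Fin n)) : Set (Fin n)) := by
  have hb'' : b' ∉ B.erase b := fun h => hb' (Finset.mem_of_mem_erase h)
  rw [linearIndepOn_finset_iff] at *
  intro f hf
  rw [Finset.sum_insert hb''] at hf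
  have h0 : f b' = 0 := by
    have h := congrArg (N ⬝ᵥ ·) hf
    simp only [dotProduct_add, dotProduct_smul, dotProduct_sum, dotProduct_zero] at h
    rw [Finset.sum_eq_zero fun c hc => by rw [hN c hc, smul_zero]] at h
    simpa [hNb] using h
  rw [h0, zero_smul, zero_add] at hf
  have h1 := hB (fun i => if i = b then 0 else f i) (by
    rw [← hf]
    by_cases hb : b ∈ B
    · rw [← Finset.add_sum_erase _ _ hb]
      simp only [if_true, zero_smul, zero_add]
      exact Finset.sum_congr rfl fun i hi => by rw [if_neg (Finset.ne_of_mem_erase hi)]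
    · rw [Finset.erase_eq_of_notMem hb]
      exact Finset.sum_congr rfl fun i hi => by rw [if_neg (by rintro rfl; exact hb hi)])
  intro i hi
  rcases Finset.mem_insert.1 hi with rfl | hi
  · exact h0
  · have := h1 i (Finset.mem_of_mem_erase hi)
    rwa [if_neg (Finset.ne_of_mem_erase hi)] at this

end Bases

/-! ### Cells cut out by a linear functional -/

section HeightCell

variable {n m : ℕ} {v : Fin n → Fin m → ℝ} {h : Fin n → ℝ}

/-- No linear functional that interpolates the heights on a basis agrees with the height of a
further index. -/
def NoExtraContact (v : Fin n → Fin m → ℝ) (h : Fin n → ℝ) : Prop :=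
  ∀ (B : Finset (Fin n)) (c : Fin m → ℝ), B.card = m → LinearIndepOn ℝ v (B : Set (Fin n)) →
    (∀ b ∈ B, c ⬝ᵥ v b = h b) → ∀ i ∉ B, c ⬝ᵥ v i ≠ h i

/-- The functional `⟨c, ·⟩` interpolates the heights on the basis `T.dirs`, lies below them on
`T.base` and above them elsewhere. -/
structure IsHeightCell (v : Fin n → Fin m → ℝ) (h : Fin n → ℝ) (T : Cell n) (c : Fin m → ℝ) :
    Prop where
  card : T.dirs.card = m
  indep : LinearIndepOn ℝ v (T.dirs : Set (Fin n))
  on_dirs : ∀ i ∈ T.dirs, c ⬝ᵥ v i = h i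
  on_base : ∀ i ∈ T.base, c ⬝ᵥ v i < h i
  off : ∀ i, i ∉ T.base → i ∉ T.dirs → h i < c ⬝ᵥ v i

lemma Cell.ext_of {T T' : Cell n} (h1 : T.base = T'.base) (h2 : T.dirs = T'.dirs) : T = T' := by
  cases T; cases T'; simp_all

lemma exists_isHeightCell (hg : NoExtraContact v h) {B : Finset (Fin n)} (hc : B.card = m)
    (hB : LinearIndepOn ℝ v (B : Set (Fin n))) :
    ∃ T c, IsHeightCell v h T c ∧ T.dirs = B := by
  classical
  obtain ⟨c, hcB⟩ := exists_dotProduct_eq_on hc hB h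
  refine ⟨⟨Finset.univ.filter fun i => c ⬝ᵥ v i < h i, B, ?_⟩, c, ⟨hc, hB, hcB, ?_, ?_⟩, rfl⟩
  · rw [Finset.disjoint_left]
    intro i hi hiB
    simp [hcB i hiB] at hi
  · intro i hi
    simpa using hi
  · intro i hi hiB
    have h1 : ¬ c ⬝ᵥ v i < h i := by simpa using hi
    exact lt_of_le_of_ne (not_lt.1 h1) (hg B c hc hB hcB i hiB).symm

lemma IsHeightCell.eq_of_dirs_eq {T T' : Cell n} {c c' : Fin m → ℝ} (hT : IsHeightCell v h T c)
    (hT' : IsHeightCell v h T' c') (hd : T.dirs = T'.dirs) : T = T' := by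
  have hc : c = c' := eq_of_dotProduct_eq_on hT.card hT.indep fun b hb => by
    rw [hT.on_dirs b hb, hT'.on_dirs b (hd ▸ hb)]
  subst hc
  refine Cell.ext_of ?_ hd
  ext i
  constructor
  · intro hi
    by_contra hi'
    have h1 : i ∉ T'.dirs := hd ▸ Finset.disjoint_left.1 T.disj hi
    exact absurd (hT.on_base i hi) (hT'.off i hi' h1).not_gt
  · intro hi
    by_contra hi'
    have h1 : i ∉ T.dirs := hd ▸ Finset.disjoint_left.1 T'.disj hi
    exact absurd (hT'.on_base i hi) (hT.off i hi' h1).not_gt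

/-- Tilting the functional of a cell around the hyperplane spanned by `T.dirs \ {b}` until it meets
the next height gives the functional of an adjacent cell. -/
lemma IsHeightCell.exists_pivot (hg : NoExtraContact v h) {T : Cell n} {c N : Fin m → ℝ}
    (hT : IsHeightCell v h T c) {b : Fin n} (hb : b ∈ T.dirs)
    (hN : ∀ i ∈ T.dirs.erase b, N ⬝ᵥ v i = 0) (hNb : N ⬝ᵥ v b ≠ 0)
    (hi : ∃ i ∉ T.dirs, 0 < (h i - c ⬝ᵥ v i) * (N ⬝ᵥ v i)) :
    ∃ b' ∉ T.dirs, ∃ s : ℝ, 0 < s ∧ 0 < (h b' - c ⬝ᵥ v b') * (N ⬝ᵥ v b') ∧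
      ∃ T' : Cell n, IsHeightCell v h T' (c + s • N) ∧ T'.dirs = insert b' (T.dirs.erase b) ∧
        T'.base = (if 0 < N ⬝ᵥ v b then T.base else insert b T.base).erase b' := by
  classical
  set w : Fin n → ℝ := fun i => h i - c ⬝ᵥ v i with hw
  set r : Fin n → ℝ := fun i => N ⬝ᵥ v i with hr
  -- Ratio test: under `c + s • N` the gap at `i` is `w i - s * r i`. It closes at `s = w i / r i`,
  -- which is positive exactly when `w i * r i > 0`; the first index met is chosen.
  obtain ⟨b', hb', hmin⟩ := Finset.exists_min_image
    (Finset.univ.filter fun i => i ∉ T.dirs ∧ 0 < w i * r i) (fun i => w i / r i)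
    (by obtain ⟨i, h1, h2⟩ := hi; exact ⟨i, by simpa using ⟨h1, h2⟩⟩)
  simp only [Finset.mem_filter, Finset.mem_univ, true_and] at hb' hmin
  obtain ⟨hb'T, hpos⟩ := hb'
  have hrb' : r b' ≠ 0 := by intro h0; simp [h0] at hpos
  set s := w b' / r b' with hs
  have hspos : 0 < s := by
    have : s = w b' * r b' / (r b') ^ 2 := by rw [hs]; field_simp
    rw [this]; positivity
  have hval : ∀ i, h i - (c + s • N) ⬝ᵥ v i = w i - s * r i := by
    intro i
    simp only [add_dotProduct, smul_dotProduct, smul_eq_mul, hw, hr]; ring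
  have hb'e : b' ∉ T.dirs.erase b := fun hh => hb'T (Finset.mem_of_mem_erase hh)
  have hcard : (insert b' (T.dirs.erase b)).card = m := by
    rw [Finset.card_insert_of_notMem hb'e, Finset.card_erase_add_one hb, hT.card]
  have hind := linearIndepOn_insert_erase hT.indep hb'T hN hrb'
  have hon : ∀ i ∈ insert b' (T.dirs.erase b), (c + s • N) ⬝ᵥ v i = h i := by
    intro i hi
    have : w i - s * r i = 0 := by
      rcases Finset.mem_insert.1 hi with rfl | hi
      · rw [hs]; field_simp; simp
      · have h1 : r i = 0 := hN i hi
        have h2 : w i = 0 := by simp [hw, hT.on_dirs i (Finset.mem_of_mem_erase hi)]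
        rw [h1, h2]; simp
    linarith [hval i]
  -- Genericity applied to the new basis excludes ties, so minimality of the ratio gives strict
  -- signs below.
  have hne : ∀ i ∉ insert b' (T.dirs.erase b), w i - s * r i ≠ 0 := by
    intro i hi h0
    exact hg _ _ hcard hind hon i hi (by linarith [hval i])
  have hwb : w b = 0 := by simp [hw, hT.on_dirs b hb]
  have hbase : ∀ i ∈ T.base, i ≠ b' → 0 < w i - s * r i := by
    intro i hi hib
    have hid := Finset.disjoint_left.1 T.disj hi
    have hwi : 0 < w i := sub_pos.2 (hT.on_base i hi)
    refine lt_of_le_of_ne ?_ (hne i ?_).symm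
    · rcases le_or_gt (r i) 0 with hri | hri
      · nlinarith
      · have := hmin i ⟨hid, mul_pos hwi hri⟩
        rw [le_div_iff₀ hri] at this
        linarith
    · simp [hib, hid]
  have hoff : ∀ i, i ∉ T.base → i ∉ T.dirs → i ≠ b' → w i - s * r i < 0 := by
    intro i hi hid hib
    have hwi : w i < 0 := sub_neg.2 (hT.off i hi hid)
    refine lt_of_le_of_ne ?_ (hne i ?_)
    · rcases le_or_gt 0 (r i) with hri | hri
      · nlinarith
      · have := hmin i ⟨hid, mul_pos_of_neg_of_neg hwi hri⟩
        rw [le_div_iff_of_neg hri] at this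
        linarith
    · simp [hib, hid]
  have hbb' : b ≠ b' := by rintro rfl; exact hb'T hb
  refine ⟨b', hb'T, s, hspos, hpos,
    ⟨(if 0 < r b then T.base else insert b T.base).erase b', insert b' (T.dirs.erase b), ?_⟩,
    ⟨hcard, hind, hon, ?_, ?_⟩, rfl, rfl⟩
  · rw [Finset.disjoint_left]
    intro i hi hi'
    obtain ⟨h1, h2⟩ := Finset.mem_erase.1 hi
    have h3 : i ∈ T.dirs.erase b := by simpa [h1] using hi'
    obtain ⟨h4, h5⟩ := Finset.mem_erase.1 h3
    have h6 : i ∈ T.base := by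
      split_ifs at h2
      · exact h2
      · simpa [h4] using h2
    exact Finset.disjoint_left.1 T.disj h6 h5
  · intro i hi
    have hv := hval i
    obtain ⟨h1, h2⟩ := Finset.mem_erase.1 hi
    suffices 0 < w i - s * r i by linarith
    by_cases hib : i = b
    · subst hib
      split_ifs at h2 with hp
      · exact absurd hb (Finset.disjoint_left.1 T.disj h2)
      · have : r i < 0 := lt_of_le_of_ne (not_lt.1 hp) hNb
        rw [hwb]; nlinarith
    · refine hbase i ?_ h1
      split_ifs at h2
      · exact h2
      · simpa [hib] using h2
  · intro i hi hi'
    have hv := hval i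
    simp only [Finset.mem_insert, not_or, Finset.mem_erase, not_and] at hi hi'
    suffices w i - s * r i < 0 by linarith
    have h2 := hi hi'.1
    by_cases hib : i = b
    · subst hib
      split_ifs at h2 with hp
      · rw [hwb]; nlinarith
      · simp at h2
    · refine hoff i ?_ (hi'.2 hib) hi'.1
      split_ifs at h2
      · exact h2
      · simpa [hib] using h2

end HeightCell

/-! ### Tiles of the regular tiling as cells of linear functionals -/

section RegularTiling

variable {n d : ℕ} {a : Fin n → Fin d → ℝ} {h : Fin n → ℝ}

/-- The vector obtained from `y ∈ ℝ^(d+2)` by deleting the height coordinate. -/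
def dropHeight (y : Fin (d + 2) → ℝ) : Fin (d + 1) → ℝ :=
  Fin.snoc (α := fun _ => ℝ) (fun k : Fin d => y k.castSucc.castSucc) (y (Fin.last _))

/-- The vector of `ℝ^(d+2)` with height coordinate `1` and other coordinates those of `-c`. -/
def upperNormal (c : Fin (d + 1) → ℝ) : Fin (d + 2) → ℝ :=
  Fin.snoc (α := fun _ => ℝ) (Fin.snoc (α := fun _ => ℝ) (fun k : Fin d => -c k.castSucc) 1)
    (-c (Fin.last d))

lemma projLift_heightLift_dotProduct (i : Fin n) (y : Fin (d + 2) → ℝ) :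
    projLift (heightLift a h i) ⬝ᵥ y =
      y (Fin.last d).castSucc * h i + dropHeight y ⬝ᵥ projLift (a i) := by
  simp only [dotProduct, dropHeight, heightLift, projLift, Fin.sum_univ_castSucc,
    Fin.snoc_castSucc, Fin.snoc_last]
  simp only [mul_comm]
  ring

@[simp] lemma upperNormal_height (c : Fin (d + 1) → ℝ) :
    upperNormal c (Fin.last d).castSucc = 1 := by
  simp [upperNormal]

@[simp] lemma dropHeight_upperNormal (c : Fin (d + 1) → ℝ) : dropHeight (upperNormal c) = -c := by
  funext k
  refine Fin.lastCases ?_ (fun k => ?_) k <;> simp [dropHeight, upperNormal]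

lemma projLift_heightLift_dotProduct_upperNormal (i : Fin n) (c : Fin (d + 1) → ℝ) :
    projLift (heightLift a h i) ⬝ᵥ upperNormal c = h i - c ⬝ᵥ projLift (a i) := by
  rw [projLift_heightLift_dotProduct]
  simp [sub_eq_add_neg]

/-- An extra contact puts `d + 2` lifted points on the non-vertical hyperplane given by `upperNormal
c`, so they are affinely dependent. Genericity then puts them on a vertical hyperplane as well,
which projects to a hyperplane of `ℝ^d` containing the points of `B`; as these affinely span `ℝ^d`,
this is impossible. -/
lemma IsGenericHeight.noExtraContact (hh : IsGenericHeight a h) :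
    NoExtraContact (fun i => projLift (a i)) h := by
  classical
  intro B c hc hB hon i hi hci
  have hcS : (insert i B).card = d + 2 := by rw [Finset.card_insert_of_notMem hi, hc]
  obtain ⟨N, hN0, hNl, t, ht⟩ := hh (insert i B) hcS fun hai => by
    rw [affineIndependent_iff_linearIndepOn_projLift] at hai
    have hy : upperNormal c = 0 := eq_of_dotProduct_eq_on hcS hai fun j hj => by
      rw [dotProduct_comm, projLift_heightLift_dotProduct_upperNormal, zero_dotProduct]
      rcases Finset.mem_insert.1 hj with rfl | hj
      · rw [hci, sub_self]
      · rw [hon j hj, sub_self]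
    have := congrFun hy (Fin.last d).castSucc
    simp at this
  have hN' : (Fin.snoc (α := fun _ => ℝ) (fun k : Fin d => N k.castSucc) (-t) :
      Fin (d + 1) → ℝ) = 0 := eq_of_dotProduct_eq_on hc hB fun b hb => by
    have h1 := ht b (Finset.mem_insert_of_mem hb)
    simp only [dotProduct, Fin.sum_univ_castSucc, heightLift, projLift, Fin.snoc_castSucc,
      Fin.snoc_last, hNl, zero_mul, add_zero] at h1 ⊢
    rw [h1]; simp
  refine hN0 (funext fun k => ?_)
  refine Fin.lastCases hNl (fun k => ?_) k
  simpa using congrFun hN' k.castSucc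

lemma sum_base_mem_zonotope {m : ℕ} (v : Fin n → Fin m → ℝ) (S : Finset (Fin n)) :
    ∑ i ∈ S, v i ∈ zonotope v := by
  classical
  refine ⟨fun i => if i ∈ S then 1 else 0, fun i => ?_, ?_⟩
  · dsimp only
    split_ifs <;> simp
  · simp [ite_smul]

lemma Cell.sum_base_mem_toSet {m : ℕ} (T : Cell n) (v : Fin n → Fin m → ℝ) :
    ∑ i ∈ T.base, v i ∈ T.toSet v :=
  ⟨0, by simp, by simp⟩

lemma Cell.sum_base_add_mem_toSet {m : ℕ} (T : Cell n) (v : Fin n → Fin m → ℝ) {b : Fin n}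
    (hb : b ∈ T.dirs) : ∑ i ∈ T.base, v i + v b ∈ T.toSet v := by
  classical
  refine ⟨fun i => if i = b then 1 else 0, fun i _ => ?_, ?_⟩
  · dsimp only
    split_ifs <;> simp
  · simp [ite_smul, hb]

lemma exists_isHeightCell_of_mem_regularTiling
    (hg : NoExtraContact (fun i => projLift (a i)) h) {T : Cell n}
    (hT : T ∈ regularTiling a h) : ∃ c, IsHeightCell (fun i => projLift (a i)) h T c := by
  classical
  obtain ⟨hc, hai, y, hy, hF⟩ := hT
  rw [affineIndependent_iff_linearIndepOn_projLift] at hai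
  set u : Fin n → Fin (d + 2) → ℝ := fun i => projLift (heightLift a h i) with hu
  set η := y (Fin.last d).castSucc with hη
  -- Rescaling the outward normal to height coordinate `1` turns its pairing with a lifted vector
  -- into a gap `h i - c ⬝ᵥ projLift (a i)`. Testing maximality against the points with one index
  -- added or removed gives the signs of the gaps.
  set c : Fin (d + 1) → ℝ := -(η⁻¹ • dropHeight y) with hcdef
  have hw : ∀ i, u i ⬝ᵥ y = η * (h i - c ⬝ᵥ projLift (a i)) := by
    intro i
    rw [hu, projLift_heightLift_dotProduct, hcdef, neg_dotProduct, smul_dotProduct, smul_eq_mul,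
      ← hη]
    field_simp
    ring
  have hz := T.sum_base_mem_toSet u
  rw [hF] at hz
  have hon : ∀ b ∈ T.dirs, c ⬝ᵥ projLift (a b) = h b := by
    intro b hb
    have hz' := T.sum_base_add_mem_toSet u hb
    rw [hF] at hz'
    have h1 := hz.2 _ hz'.1
    have h2 := hz'.2 _ hz.1
    rw [add_dotProduct] at h1 h2
    have h3 : η * (h b - c ⬝ᵥ projLift (a b)) = 0 := by rw [← hw]; linarith
    rcases mul_eq_zero.1 h3 with h4 | h4
    · exact absurd h4 hy.ne'
    · linarith
  have hne := hg T.dirs c hc hai hon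
  refine ⟨c, hc, hai, hon, fun i hi => ?_, fun i hi hid => ?_⟩
  · refine lt_of_le_of_ne ?_ (hne i (Finset.disjoint_left.1 T.disj hi))
    have h1 := hz.2 _ (sum_base_mem_zonotope u (T.base.erase i))
    rw [← Finset.add_sum_erase _ _ hi, add_dotProduct, hw] at h1
    have h2 : 0 ≤ η * (h i - c ⬝ᵥ projLift (a i)) := by linarith
    have := nonneg_of_mul_nonneg_right h2 hy
    linarith
  · refine lt_of_le_of_ne ?_ (hne i hid).symm
    have h1 := hz.2 _ (sum_base_mem_zonotope u (insert i T.base))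
    rw [Finset.sum_insert hi, add_dotProduct, hw] at h1
    have h2 : η * (h i - c ⬝ᵥ projLift (a i)) ≤ 0 := by linarith
    by_contra! h3
    nlinarith

lemma IsHeightCell.mem_regularTiling {T : Cell n} {c : Fin (d + 1) → ℝ}
    (hT : IsHeightCell (fun i => projLift (a i)) h T c) : T ∈ regularTiling a h := by
  classical
  refine ⟨hT.card, (affineIndependent_iff_linearIndepOn_projLift _ _).2 hT.indep,
    upperNormal c, by simp, ?_⟩
  set u : Fin n → Fin (d + 2) → ℝ := fun i => projLift (heightLift a h i) with hu
  set w : Fin n → ℝ := fun i => h i - c ⬝ᵥ projLift (a i) with hw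
  have huw : ∀ i, u i ⬝ᵥ upperNormal c = w i := fun i =>
    projLift_heightLift_dotProduct_upperNormal i c
  have hdirs : ∀ i ∈ T.dirs, w i = 0 := fun i hi => sub_eq_zero.2 (hT.on_dirs i hi).symm
  have hbase : ∀ i ∈ T.base, 0 < w i := fun i hi => sub_pos.2 (hT.on_base i hi)
  have hoff : ∀ i, i ∉ T.base → i ∉ T.dirs → w i < 0 := fun i hi hi' =>
    sub_neg.2 (hT.off i hi hi')
  have hsum : ∀ α : Fin n → ℝ, (∑ i, α i • u i) ⬝ᵥ upperNormal c = ∑ i, α i * w i := by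
    intro α
    rw [sum_dotProduct]
    exact Finset.sum_congr rfl fun i _ => by rw [smul_dotProduct, huw, smul_eq_mul]
  have hterm : ∀ α : Fin n → ℝ, (∀ i, 0 ≤ α i ∧ α i ≤ 1) →
      ∀ i, α i * w i ≤ if i ∈ T.base then w i else 0 := by
    intro α hα i
    split_ifs with hi
    · have := hbase i hi
      nlinarith [hα i]
    · by_cases hid : i ∈ T.dirs
      · rw [hdirs i hid]; simp
      · have := hoff i hi hid
        nlinarith [hα i]
  have hmax : ∀ z ∈ zonotope u, z ⬝ᵥ upperNormal c ≤ ∑ i ∈ T.base, w i := by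
    rintro _ ⟨α, hα, rfl⟩
    rw [hsum]
    refine (Finset.sum_le_sum fun i _ => hterm α hα i).trans ?_
    simp
  ext z
  constructor
  · rintro ⟨α, hα, rfl⟩
    refine ⟨⟨fun i => if i ∈ T.base then 1 else if i ∈ T.dirs then α i else 0, fun i => ?_, ?_⟩, ?_⟩
    · dsimp only
      split_ifs with h1 h2
      · simp
      · exact hα i h2
      · simp
    · rw [← Finset.sum_subset (Finset.subset_univ (T.base ∪ T.dirs)), Finset.sum_union T.disj]
      · congr 1
        · exact Finset.sum_congr rfl fun i hi => by simp [hi]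
        · exact Finset.sum_congr rfl fun i hi => by
            simp [hi, Finset.disjoint_right.1 T.disj hi]
      · intro i _ hi
        rw [Finset.mem_union, not_or] at hi
        simp [hi.1, hi.2]
    · intro z hz
      refine (hmax z hz).trans (le_of_eq ?_)
      rw [add_dotProduct, sum_dotProduct, sum_dotProduct,
        Finset.sum_eq_zero (s := T.dirs) fun i hi => by
          rw [smul_dotProduct, huw, hdirs i hi, smul_zero], add_zero]
      exact Finset.sum_congr rfl fun i _ => (huw i).symm
  · rintro ⟨⟨α, hα, rfl⟩, hz⟩
    have h1 := hz _ (sum_base_mem_zonotope u T.base)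
    rw [hsum, sum_dotProduct, Finset.sum_congr rfl fun i _ => huw i] at h1
    have h2 : ∑ i, α i * w i = ∑ i, if i ∈ T.base then w i else 0 := by
      refine le_antisymm (Finset.sum_le_sum fun i _ => hterm α hα i) ?_
      simpa using h1
    -- Complementary slackness: a maximiser attains every termwise bound, hence has coefficient `1`
    -- on `base` and `0` off `base ∪ dirs`.
    have h3 := (Finset.sum_eq_sum_iff_of_le fun i _ => hterm α hα i).1 h2
    refine ⟨α, fun b _ => hα b, ?_⟩
    rw [← Finset.sum_subset (Finset.subset_univ (T.base ∪ T.dirs)), Finset.sum_union T.disj]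
    · congr 1
      refine Finset.sum_congr rfl fun i hi => ?_
      have := h3 i (Finset.mem_univ i)
      rw [if_pos hi] at this
      rw [(mul_eq_right₀ (hbase i hi).ne').1 this, one_smul]
    · intro i _ hi
      rw [Finset.mem_union, not_or] at hi
      have := h3 i (Finset.mem_univ i)
      rw [if_neg hi.1] at this
      rw [(mul_eq_zero.1 this).resolve_right (hoff i hi.1 hi.2).ne, zero_smul]

end RegularTiling

/-! ### Oriented adjacency and generic points -/

section Adjacency

variable {n d : ℕ} {a : Fin n → Fin d → ℝ} {h : Fin n → ℝ} {x : Fin d → ℝ}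

lemma exists_isSharedFacet {P : Set (Cell n)} {T T' : Cell n} (hT : T ∈ P) (hT' : T' ∈ P)
    {b b' : Fin n} (hb : b ∈ T.dirs) (hb' : b' ∉ T.dirs) {J : Finset (Fin n)}
    (hJ : J = T.base ∨ J = insert b T.base) (hd : T'.dirs = insert b' (T.dirs.erase b))
    (hbase : T'.base = J.erase b') :
    ∃ F : Cell n, F.dirs = T.dirs.erase b ∧ IsSharedFacet P F T' T := by
  have hbb' : b ≠ b' := by rintro rfl; exact hb' hb
  have hbT' : b ∉ T'.dirs := by simp [hd, hbb']
  refine ⟨⟨J, T.dirs.erase b, ?_⟩, rfl, hT', hT, ?_, ⟨b', by simp [hd], ?_, ?_⟩, ⟨b, hb, rfl, hJ⟩⟩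
  · rw [Finset.disjoint_left]
    intro i hi hi'
    obtain ⟨h1, h2⟩ := Finset.mem_erase.1 hi'
    rcases hJ with rfl | rfl
    · exact Finset.disjoint_left.1 T.disj hi h2
    · exact Finset.disjoint_left.1 T.disj (Finset.mem_of_mem_insert_of_ne hi h1) h2
  · rintro rfl
    exact hbT' hb
  · simp [hd, hb']
  · dsimp only
    by_cases hJb : b' ∈ J
    · right; rw [hbase, Finset.insert_erase hJb]
    · left; rw [hbase, Finset.erase_eq_of_notMem hJb]

lemma dotProduct_sum_smul_of_dual {m : ℕ} {v : Fin n → Fin m → ℝ} {B : Finset (Fin n)}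
    {b : Fin n} (hb : b ∈ B) {N : Fin m → ℝ} (hN : ∀ i ∈ B.erase b, N ⬝ᵥ v i = 0)
    (l : Fin n → ℝ) : N ⬝ᵥ (∑ i ∈ B, l i • v i) = l b * (N ⬝ᵥ v b) := by
  rw [dotProduct_sum, ← Finset.add_sum_erase _ _ hb, dotProduct_smul, smul_eq_mul,
    Finset.sum_eq_zero fun i hi => by rw [dotProduct_smul, hN i hi, smul_zero], add_zero]

lemma exists_dual {m : ℕ} {v : Fin n → Fin m → ℝ} {B : Finset (Fin n)} (hc : B.card = m)
    (hB : LinearIndepOn ℝ v (B : Set (Fin n))) {b : Fin n} (hb : b ∈ B) :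
    ∃ N : Fin m → ℝ, N ⬝ᵥ v b = 1 ∧ ∀ i ∈ B.erase b, N ⬝ᵥ v i = 0 := by
  obtain ⟨N, hN⟩ := exists_dotProduct_eq_on hc hB (Pi.single b 1)
  refine ⟨N, by simp [hN b hb], fun i hi => ?_⟩
  rw [hN i (Finset.mem_of_mem_erase hi), Pi.single_eq_of_ne (Finset.ne_of_mem_erase hi)]

lemma mem_affineSpan_of_dual_eq_zero {B : Finset (Fin n)} (hc : B.card = d + 1)
    (hB : LinearIndepOn ℝ (fun i => projLift (a i)) (B : Set (Fin n))) {b : Fin n} (hb : b ∈ B)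
    {N : Fin (d + 1) → ℝ} (hN : ∀ i ∈ B.erase b, N ⬝ᵥ projLift (a i) = 0)
    (hNb : N ⬝ᵥ projLift (a b) ≠ 0) (hNx : N ⬝ᵥ projLift x = 0) :
    x ∈ affineSpan ℝ (a '' ((B.erase b : Finset (Fin n)) : Set (Fin n))) := by
  obtain ⟨l, hl⟩ := exists_sum_smul_eq hc hB (projLift x)
  have h1 := dotProduct_sum_smul_of_dual hb hN l
  rw [hl, hNx] at h1
  have hlb : l b = 0 := (mul_eq_zero.1 h1.symm).resolve_right hNb
  rw [← Finset.add_sum_erase _ _ hb, hlb, zero_smul, zero_add, sum_smul_projLift] at hl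
  have h2 : (Finset.affineCombination ℝ (B.erase b) a) l = x := by
    rw [Finset.affineCombination_eq_linear_combination _ _ _ hl.1, hl.2]
  rw [← h2]
  exact affineCombination_mem_affineSpan_image hl.1 (fun i hi hi' => absurd hi hi') a

/-- If a coordinate of `(x, 1)` with respect to the basis of a tile vanishes, then so does the
same coordinate of every vector other than the basis vector itself. -/
lemma IsHeightCell.dual_eq_zero (hg : NoExtraContact (fun i => projLift (a i)) h)
    (hxg : IsGenericForTiling a (regularTiling a h) x) {T : Cell n} {c N : Fin (d + 1) → ℝ}
    (hT : IsHeightCell (fun i => projLift (a i)) h T c) {b : Fin n} (hb : b ∈ T.dirs)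
    (hN : ∀ i ∈ T.dirs.erase b, N ⬝ᵥ projLift (a i) = 0) (hNb : N ⬝ᵥ projLift (a b) ≠ 0)
    (hNx : N ⬝ᵥ projLift x = 0) {i : Fin n} (hib : i ≠ b) : N ⬝ᵥ projLift (a i) = 0 := by
  by_contra hNi
  have hid : i ∉ T.dirs := fun hid => hNi (hN i (Finset.mem_erase.2 ⟨hib, hid⟩))
  have hwi : h i - c ⬝ᵥ projLift (a i) ≠ 0 :=
    sub_ne_zero.2 (hg T.dirs c hT.card hT.indep hT.on_dirs i hid).symm
  -- A pivot in direction `M` would make the facet on `T.dirs.erase b` internal, although `x` lies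
  -- in its affine span. If `N` does not vanish at `i`, one of `N` and `-N` permits such a pivot.
  have key : ∀ M : Fin (d + 1) → ℝ, (∀ i ∈ T.dirs.erase b, M ⬝ᵥ projLift (a i) = 0) →
      M ⬝ᵥ projLift (a b) ≠ 0 →
      ¬ 0 < (h i - c ⬝ᵥ projLift (a i)) * (M ⬝ᵥ projLift (a i)) := by
    intro M hM hMb hpos
    obtain ⟨b', hb', s, -, -, T', hT', hd, hbase⟩ := hT.exists_pivot hg hb hM hMb ⟨i, hid, hpos⟩
    obtain ⟨F, hF, hsh⟩ := exists_isSharedFacet hT.mem_regularTiling hT'.mem_regularTiling hb hb'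
      (by split_ifs <;> simp) hd hbase
    refine hxg F T' T hsh ?_
    rw [hF]
    exact mem_affineSpan_of_dual_eq_zero hT.card hT.indep hb hN hNb hNx
  rcases lt_or_gt_of_ne (mul_ne_zero hwi hNi) with hlt | hgt
  · refine key (-N) (fun j hj => by rw [neg_dotProduct, hN j hj, neg_zero])
      (by rw [neg_dotProduct]; exact neg_ne_zero.2 hNb) ?_
    rw [neg_dotProduct]; linarith
  · exact key N hN hNb hgt

/-- A small step from `z` along `-N` stays in `S` and strictly lowers the pairing with `N`. -/
lemma dotProduct_lt_of_mem_interior {m : ℕ} {S : Set (Fin m → ℝ)} {N z : Fin m → ℝ} (hN : N ≠ 0)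
    {r : ℝ} (hS : ∀ y ∈ S, r ≤ N ⬝ᵥ y) (hz : z ∈ interior S) : r < N ⬝ᵥ z := by
  have hcont : Continuous fun t : ℝ => z - t • N := by fun_prop
  have hnhds : ∀ᶠ t : ℝ in nhds 0, z - t • N ∈ S :=
    hcont.continuousAt (by simpa using mem_interior_iff_mem_nhds.1 hz)
  obtain ⟨t, ht, htS⟩ := ((hnhds.filter_mono nhdsWithin_le_nhds).and
    (self_mem_nhdsWithin : Set.Ioi (0 : ℝ) ∈ nhdsWithin 0 (Set.Ioi 0))).exists
  have h1 := hS _ ht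
  rw [dotProduct_sub, dotProduct_smul, smul_eq_mul] at h1
  have h2 : 0 < N ⬝ᵥ N := by
    refine lt_of_le_of_ne (Finset.sum_nonneg fun i _ => mul_self_nonneg _) ?_
    exact fun h0 => hN (dotProduct_self_eq_zero.1 h0.symm)
  have h3 : 0 < t * (N ⬝ᵥ N) := mul_pos htS h2
  linarith

/-- The adjacent cell obtained by tilting the functional upwards at `x` is a predecessor in the
oriented adjacency graph. -/
lemma IsHeightCell.adj_of_pivot {T T' : Cell n} {c c' N : Fin (d + 1) → ℝ}
    (hT : IsHeightCell (fun i => projLift (a i)) h T c)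
    (hT' : IsHeightCell (fun i => projLift (a i)) h T' c') {b b' : Fin n} (hb : b ∈ T.dirs)
    (hb' : b' ∉ T.dirs) (hN : ∀ i ∈ T.dirs.erase b, N ⬝ᵥ projLift (a i) = 0)
    (hNb : 0 < N ⬝ᵥ projLift (a b)) (hNx : 0 < N ⬝ᵥ projLift x)
    (hpos : 0 < (h b' - c ⬝ᵥ projLift (a b')) * (N ⬝ᵥ projLift (a b')))
    (hd : T'.dirs = insert b' (T.dirs.erase b)) (hbase : T'.base = T.base.erase b') :
    (orientedAdjacencyGraph a (regularTiling a h) x).Adj T' T := by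
  obtain ⟨F, hF, hsh⟩ := exists_isSharedFacet hT.mem_regularTiling hT'.mem_regularTiling hb hb'
    (Or.inl rfl) hd hbase
  refine ⟨F, hsh, fun M hM0 hM z' hz' z hz => ?_⟩
  rw [hF] at hM
  have hN0 : N ≠ 0 := by rintro rfl; simp at hNb
  -- The normals of a facet form a line, and `t` multiplies both sides of the sign condition; hence
  -- only `N` has to be treated.
  obtain ⟨t, rfl⟩ : ∃ t : ℝ, M = t • N := by
    refine ⟨(M ⬝ᵥ projLift (a b)) / (N ⬝ᵥ projLift (a b)),
      eq_of_dotProduct_eq_on hT.card hT.indep fun i hi => ?_⟩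
    rw [smul_dotProduct, smul_eq_mul]
    by_cases hib : i = b
    · subst hib
      field_simp
    · have hie := Finset.mem_erase.2 ⟨hib, hi⟩
      rw [hM i hie, hN i hie, mul_zero]
  set m := N ⬝ᵥ ∑ i ∈ T.base, projLift (a i) with hm
  have hz1 : m < N ⬝ᵥ z := by
    refine dotProduct_lt_of_mem_interior hN0 ?_ hz
    rintro _ ⟨α, hα, rfl⟩
    rw [dotProduct_add, dotProduct_sum_smul_of_dual hb hN]
    have := mul_nonneg (hα b hb).1 hNb.le
    linarith
  -- The hyperplane `N = m` of the shared facet bounds `T'` from above: either `b'` leaves `base`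
  -- and `N` is positive on its vector, or `b'` is new and `N` is negative there.
  have hz2 : N ⬝ᵥ z' ≤ m := by
    obtain ⟨α, hα, rfl⟩ := interior_subset hz'
    have hb'T' : b' ∈ T'.dirs := by simp [hd]
    have hN' : ∀ i ∈ T'.dirs.erase b', N ⬝ᵥ projLift (a i) = 0 := by
      intro i hi
      obtain ⟨h1, h2⟩ := Finset.mem_erase.1 hi
      rw [hd] at h2
      exact hN i (Finset.mem_of_mem_insert_of_ne h2 h1)
    rw [dotProduct_add, dotProduct_sum_smul_of_dual hb'T' hN', hbase]
    have hαb := hα b' hb'T'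
    by_cases hbb : b' ∈ T.base
    · have h1 : 0 < N ⬝ᵥ projLift (a b') :=
        (pos_iff_pos_of_mul_pos hpos).1 (sub_pos.2 (hT.on_base b' hbb))
      rw [hm, ← Finset.add_sum_erase _ _ hbb, dotProduct_add]
      nlinarith
    · have h1 : N ⬝ᵥ projLift (a b') < 0 :=
        (neg_iff_neg_of_mul_pos hpos).1 (sub_neg.2 (hT.off b' hbb hb'))
      rw [Finset.erase_eq_of_notMem hbb]
      nlinarith
  have h3 : 0 < N ⬝ᵥ (z - z') := by rw [dotProduct_sub]; linarith
  rw [smul_dotProduct, smul_dotProduct, smul_eq_mul, smul_eq_mul, sign_mul, sign_mul,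
    sign_pos hNx, sign_pos h3]

end Adjacency

/-! ### Predecessors of supported tiles -/

section Predecessor

variable {n d : ℕ} {a : Fin n → Fin d → ℝ} {h : Fin n → ℝ} {x : Fin d → ℝ}

lemma exists_neg_of_sum_eq_zero {ι : Type*} [Fintype ι] {f : ι → ℝ} (hf : ∑ i, f i = 0) {j : ι}
    (hj : 0 < f j) : ∃ i, f i < 0 := by
  by_contra! hall
  exact hj.ne' ((Finset.sum_eq_zero_iff_of_nonneg fun i _ => hall i).1 hf j (Finset.mem_univ j))

/-- Moving a nonnegative vector in a direction with a negative entry until the first entry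
vanishes. -/
lemma exists_add_mul_nonneg_eq_zero {ι : Type*} [Fintype ι] {μ γ : ι → ℝ} (hμ : ∀ i, 0 ≤ μ i)
    (hγ : ∃ i, γ i < 0) :
    ∃ t b, γ b < 0 ∧ μ b + t * γ b = 0 ∧ ∀ i, 0 ≤ μ i + t * γ i := by
  classical
  obtain ⟨b, hb, hmin⟩ := Finset.exists_min_image (Finset.univ.filter fun i => γ i < 0)
    (fun i => μ i / -γ i) (by obtain ⟨i, hi⟩ := hγ; exact ⟨i, by simpa using hi⟩)
  simp only [Finset.mem_filter, Finset.mem_univ, true_and] at hb hmin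
  have ht : 0 ≤ μ b / -γ b := div_nonneg (hμ b) (by linarith)
  refine ⟨μ b / -γ b, b, hb, ?_, fun i => ?_⟩
  · rw [div_mul_eq_mul_div, div_neg, mul_div_cancel_right₀ _ hb.ne, add_neg_cancel]
  · rcases lt_or_ge (γ i) 0 with hi | hi
    · have := hmin i hi
      rw [le_div_iff₀ (by linarith)] at this
      linarith
    · have := hμ i
      positivity

lemma IsHeightCell.exists_removable_direction
    (hg : NoExtraContact (fun i => projLift (a i)) h)
    (hxg : IsGenericForTiling a (regularTiling a h) x) {T : Cell n} {c : Fin (d + 1) → ℝ}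
    (hT : IsHeightCell (fun i => projLift (a i)) h T c) (hsupp : T.SupportedOn a x)
    (hord : T.order ≠ 0) {l : Fin n → ℝ}
    (hl : ∑ b ∈ T.dirs, l b • projLift (a b) = projLift x) :
    ∃ b ∈ T.dirs, 0 < l b ∧ ∃ ν : Fin n → ℝ, (∀ i, 0 ≤ ν i) ∧
      (∀ i ∉ T.base ∪ T.dirs.erase b, ν i = 0) ∧ ∑ i, ν i • projLift (a i) = projLift x := by
  classical
  have hext : ∀ (f : Fin n → ℝ), ∑ i, (if i ∈ T.dirs then f i else 0) • projLift (a i) =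
      ∑ b ∈ T.dirs, f b • projLift (a b) := by
    intro f
    simp [ite_smul]
  -- The entries of an affine relation `γ` sum to zero, so a positive entry forces a negative one,
  -- necessarily in `dirs`. Moving `μ` along `γ` to its first vanishing entry removes such an index
  -- from the representation of `x`.
  have main : ∀ μ γ : Fin n → ℝ, (∀ i, 0 ≤ μ i) → (∀ i ∉ T.base ∪ T.dirs, μ i = 0) →
      ∑ i, μ i • projLift (a i) = projLift x → (∀ i ∉ T.dirs, 0 ≤ γ i) →
      (∀ i ∉ T.base ∪ T.dirs, γ i = 0) → ∑ i, γ i • projLift (a i) = 0 → (∃ j, 0 < γ j) →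
      (∀ b ∈ T.dirs, γ b < 0 → 0 < l b) →
      ∃ b ∈ T.dirs, 0 < l b ∧ ∃ ν : Fin n → ℝ, (∀ i, 0 ≤ ν i) ∧
      (∀ i ∉ T.base ∪ T.dirs.erase b, ν i = 0) ∧ ∑ i, ν i • projLift (a i) = projLift x := by
    intro μ γ hμ hμS hμx hγ hγS hγ0 hγj hγl
    obtain ⟨j, hj⟩ := hγj
    obtain ⟨t, b, hb, hb0, hnn⟩ := exists_add_mul_nonneg_eq_zero hμ
      (exists_neg_of_sum_eq_zero ((sum_smul_projLift_eq_zero _ _ _).1 hγ0).1 hj)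
    have hbd : b ∈ T.dirs := by
      by_contra hbd
      exact absurd (hγ b hbd) (not_le.2 hb)
    refine ⟨b, hbd, hγl b hbd hb, fun i => μ i + t * γ i, hnn, fun i hi => ?_, ?_⟩
    · by_cases hib : i = b
      · subst hib; exact hb0
      · have : i ∉ T.base ∪ T.dirs := by simpa [hib] using hi
        simp [hμS i this, hγS i this]
    · simp only [add_smul, mul_smul, Finset.sum_add_distrib]
      rw [← Finset.smul_sum, hγ0, hμx, smul_zero, add_zero]
  -- If a coordinate is negative, the relation is the difference of a convex representation `μ` and
  -- `l`: it is negative only where `l b > μ b ≥ 0`. Otherwise `l` is itself a convex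
  -- representation, and the relation expresses some `i ∈ T.base` in the basis.
  by_cases hneg : ∃ b ∈ T.dirs, l b < 0
  · obtain ⟨μ, hμ, hμS, hμx⟩ := (mem_convexHull_image_iff _ _ _).1 hsupp
    obtain ⟨b, hb, hlb⟩ := hneg
    refine main μ (fun i => μ i - if i ∈ T.dirs then l i else 0) hμ hμS hμx ?_ ?_ ?_ ⟨b, ?_⟩ ?_
    · intro i hi
      simpa [hi] using hμ i
    · intro i hi
      have h1 := hμS i hi
      rw [Finset.mem_union, not_or] at hi
      simp [hi.2, h1]
    · simp only [sub_smul, Finset.sum_sub_distrib]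
      rw [hext, hμx, hl, sub_self]
    · have := hμ b
      simp only [hb, if_true]
      linarith
    · intro b hb hlt
      have := hμ b
      simp only [hb, if_true] at hlt
      linarith
  · push Not at hneg
    obtain ⟨i, hi⟩ : T.base.Nonempty := Finset.card_ne_zero.1 hord
    have hid := Finset.disjoint_left.1 T.disj hi
    obtain ⟨g, hgi⟩ := exists_sum_smul_eq hT.card hT.indep (projLift (a i))
    refine main (fun j => if j ∈ T.dirs then l j else 0)
      (fun j => (Pi.single i 1 : Fin n → ℝ) j - if j ∈ T.dirs then g j else 0) ?_ ?_ ?_ ?_ ?_ ?_ ⟨i, ?_⟩ ?_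
    · intro j
      split_ifs with hj
      · exact hneg j hj
      · exact le_rfl
    · intro j hj
      rw [Finset.mem_union, not_or] at hj
      simp [hj.2]
    · rw [hext, hl]
    · intro j hj
      by_cases hij : j = i
      · subst hij; simp [hj]
      · simp [hj, hij]
    · intro j hj
      rw [Finset.mem_union, not_or] at hj
      have hji : j ≠ i := by rintro rfl; exact hj.1 hi
      simp [hj.2, hji]
    · simp only [sub_smul, Finset.sum_sub_distrib]
      rw [hext, hgi]
      simp [Pi.single_apply, ite_smul]
    · simp [hid]
    · intro b hb hlt
      have hbi : i ≠ b := by rintro rfl; exact hid hb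
      rw [Pi.single_eq_of_ne hbi.symm, if_pos hb] at hlt
      -- Were `l b = 0`, genericity of `x` through `dual_eq_zero` would force `g b = 0`, whereas the
      -- entry `-g b` of the relation is negative.
      refine lt_of_le_of_ne (hneg b hb) fun h0 => ?_
      obtain ⟨N, hNb, hN⟩ := exists_dual hT.card hT.indep hb
      have h1 := dotProduct_sum_smul_of_dual hb hN l
      have h2 := dotProduct_sum_smul_of_dual hb hN g
      rw [hl, ← h0, zero_mul] at h1
      rw [hgi, hNb, hT.dual_eq_zero hg hxg hb hN (by simp [hNb]) h1 hbi] at h2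
      linarith

lemma IsHeightCell.exists_predecessor (hg : NoExtraContact (fun i => projLift (a i)) h)
    (hxg : IsGenericForTiling a (regularTiling a h) x) {T : Cell n} {c : Fin (d + 1) → ℝ}
    (hT : IsHeightCell (fun i => projLift (a i)) h T c) (hsupp : T.SupportedOn a x)
    (hord : T.order ≠ 0) :
    ∃ T' c', IsHeightCell (fun i => projLift (a i)) h T' c' ∧ T'.SupportedOn a x ∧
      T'.order ≤ T.order ∧ c ⬝ᵥ projLift x < c' ⬝ᵥ projLift x ∧
      (orientedAdjacencyGraph a (regularTiling a h) x).Adj T' T := by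
  classical
  obtain ⟨l, hl⟩ := exists_sum_smul_eq hT.card hT.indep (projLift x)
  obtain ⟨b, hb, hlb, ν, hν, hνS, hνx⟩ := hT.exists_removable_direction hg hxg hsupp hord hl
  obtain ⟨N, hNb, hN⟩ := exists_dual hT.card hT.indep hb
  have hNx : 0 < N ⬝ᵥ projLift x := by
    rw [← hl, dotProduct_sum_smul_of_dual hb hN, hNb]
    linarith
  -- `N` is positive at `x` and zero on `T.dirs.erase b`, so the weights `ν` charge an index of
  -- `base` where `N` is positive. Its height lies above `c`, which guarantees that the tilting
  -- meets something.
  obtain ⟨i, hi⟩ : ∃ i, 0 < ν i * (N ⬝ᵥ projLift (a i)) := by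
    by_contra! hall
    rw [← hνx, dotProduct_sum] at hNx
    refine hNx.not_ge (Finset.sum_nonpos fun i _ => ?_)
    rw [dotProduct_smul]
    exact hall i
  have hνi : ν i ≠ 0 := by rintro h0; simp [h0] at hi
  have hNi : 0 < N ⬝ᵥ projLift (a i) :=
    (pos_iff_pos_of_mul_pos hi).1 (lt_of_le_of_ne (hν i) hνi.symm)
  have hibase : i ∈ T.base := by
    have h1 : i ∈ T.base ∪ T.dirs.erase b := by
      by_contra h1
      exact hνi (hνS i h1)
    refine (Finset.mem_union.1 h1).resolve_right fun h2 => ?_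
    rw [hN i h2] at hNi
    exact lt_irrefl _ hNi
  have hNb0 : 0 < N ⬝ᵥ projLift (a b) := by simp [hNb]
  obtain ⟨b', hb', s, hs, hpos, T', hT', hd, hbase⟩ := hT.exists_pivot hg hb hN hNb0.ne'
    ⟨i, Finset.disjoint_left.1 T.disj hibase, mul_pos (sub_pos.2 (hT.on_base i hibase)) hNi⟩
  rw [if_pos hNb0] at hbase
  refine ⟨T', _, hT', ?_, ?_, ?_, hT.adj_of_pivot hT' hb hb' hN hNb0 hNx hpos hd hbase⟩
  · refine (mem_convexHull_image_iff _ _ _).2 ⟨ν, hν, fun j hj => hνS j fun hj' => hj ?_, hνx⟩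
    rw [hd, hbase]
    simp only [Finset.mem_union, Finset.mem_erase, Finset.mem_insert] at hj' ⊢
    tauto
  · rw [Cell.order, Cell.order, hbase]
    exact Finset.card_le_card (Finset.erase_subset _ _)
  · rw [add_dotProduct, smul_dotProduct, smul_eq_mul]
    have := mul_pos hs hNx
    linarith

instance : Finite (Cell n) :=
  Finite.of_injective (fun T : Cell n => (T.base, T.dirs)) fun _ _ hTT' =>
    Cell.ext_of (congrArg Prod.fst hTT') (congrArg Prod.snd hTT')

/-- The value at `(x, 1)` of the functional of a cell, and `0` if there is none. -/
def cellPotential (a : Fin n → Fin d → ℝ) (h : Fin n → ℝ) (x : Fin d → ℝ) (T : Cell n) : ℝ :=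
  open Classical in
  if hT : ∃ c, IsHeightCell (fun i => projLift (a i)) h T c then hT.choose ⬝ᵥ projLift x else 0

lemma IsHeightCell.cellPotential_eq {T : Cell n} {c : Fin (d + 1) → ℝ}
    (hT : IsHeightCell (fun i => projLift (a i)) h T c) :
    cellPotential a h x T = c ⬝ᵥ projLift x := by
  have hex : ∃ c, IsHeightCell (fun i => projLift (a i)) h T c := ⟨c, hT⟩
  have hc : hex.choose = c := eq_of_dotProduct_eq_on hT.card hT.indep fun b hb => by
    rw [hex.choose_spec.on_dirs b hb, hT.on_dirs b hb]
  rw [cellPotential, dif_pos hex, hc]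

/-- Well-founded induction along increasing potential. The lower bound on potentials along the path
is carried so that the appended endpoint, of strictly smaller potential, cannot repeat an earlier
tile. -/
lemma exists_directedPath_from_order_zero (hg : NoExtraContact (fun i => projLift (a i)) h)
    (hxg : IsGenericForTiling a (regularTiling a h) x) (T : Cell n)
    (hT : T ∈ regularTiling a h) (hsupp : T.SupportedOn a x) :
    ∃ (T₀ : Cell n) (p : List (Cell n)),
      (T₀ ∈ regularTiling a h ∧ T₀.order = 0 ∧ T₀.SupportedOn a x) ∧
      IsDirectedPath (orientedAdjacencyGraph a (regularTiling a h) x) T₀ T p ∧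
      ∀ T' ∈ p, (T' ∈ regularTiling a h ∧ T'.SupportedOn a x ∧ T'.order ≤ T.order) ∧
        cellPotential a h x T ≤ cellPotential a h x T' := by
  have hwf : WellFounded fun T T' : Cell n => cellPotential a h x T' < cellPotential a h x T :=
    @Finite.wellFounded_of_trans_of_irrefl _ _ _ ⟨fun _ _ _ h1 h2 => h2.trans h1⟩
      ⟨fun _ => lt_irrefl _⟩
  induction T using hwf.induction with
  | _ T ih =>
    by_cases hord : T.order = 0
    · refine ⟨T, [T], ⟨hT, hord, hsupp⟩, ⟨by simp, by simp, rfl, rfl⟩, fun T' hT' => ?_⟩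
      rw [List.mem_singleton] at hT'
      subst hT'
      exact ⟨⟨hT, hsupp, le_rfl⟩, le_rfl⟩
    · obtain ⟨c, hc⟩ := exists_isHeightCell_of_mem_regularTiling hg hT
      obtain ⟨T₁, c₁, hc₁, hsupp₁, hord₁, hlt, hadj⟩ := hc.exists_predecessor hg hxg hsupp hord
      rw [← hc.cellPotential_eq, ← hc₁.cellPotential_eq] at hlt
      obtain ⟨T₀, p, hT₀, ⟨hp1, hp2, hp3, hp4⟩, hp⟩ := ih T₁ hlt hc₁.mem_regularTiling hsupp₁
      refine ⟨T₀, p ++ [T], hT₀, ⟨?_, ?_, ?_, by simp⟩, fun T' hT' => ?_⟩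
      · refine List.isChain_append.2 ⟨hp1, by simp, fun y hy z hz => ?_⟩
        rw [hp4] at hy
        simp only [Option.mem_def, Option.some.injEq, List.head?_cons] at hy hz
        rwa [← hy, ← hz]
      · rw [List.nodup_append]
        refine ⟨hp2, by simp, fun y hy z hz hyz => ?_⟩
        rw [List.mem_singleton] at hz
        subst hyz hz
        exact absurd (hp _ hy).2 (not_le.2 hlt)
      · simp [List.head?_append, hp3]
      · rcases List.mem_append.1 hT' with hT' | hT'
        · obtain ⟨⟨h1, h2, h3⟩, h4⟩ := hp T' hT'
          exact ⟨⟨h1, h2, h3.trans hord₁⟩, hlt.le.trans h4⟩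
        · rw [List.mem_singleton] at hT'
          subst hT'
          exact ⟨⟨hT, hsupp, le_rfl⟩, le_rfl⟩

end Predecessor

/-! ### Existence and uniqueness of the supported tile of order zero -/

section OrderZero

variable {n d : ℕ} {a : Fin n → Fin d → ℝ} {h : Fin n → ℝ} {x : Fin d → ℝ}

lemma span_range_projLift_eq_top (ha : affineSpan ℝ (Set.range a) = ⊤) :
    Submodule.span ℝ (Set.range fun i => projLift (a i)) = ⊤ := by
  have hmem : ∀ p : Fin d → ℝ,
      projLift p ∈ Submodule.span ℝ (Set.range fun i => projLift (a i)) := by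
    intro p
    have hp : p ∈ affineSpan ℝ (Set.range a) := by rw [ha]; trivial
    obtain ⟨w, hw1, hw2⟩ := eq_affineCombination_of_mem_affineSpan_of_fintype hp
    rw [Finset.affineCombination_eq_linear_combination _ _ _ hw1] at hw2
    rw [← (sum_smul_projLift _ w a p).2 ⟨hw1, hw2.symm⟩]
    exact Submodule.sum_mem _ fun i _ => Submodule.smul_mem _ _ (Submodule.subset_span ⟨i, rfl⟩)
  rw [eq_top_iff]
  intro u _
  have hu : u = projLift (fun k => u k.castSucc) + (u (Fin.last d) - 1) • projLift 0 := by
    funext k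
    refine Fin.lastCases ?_ (fun k => ?_) k <;> simp
  rw [hu]
  exact Submodule.add_mem _ (hmem _) (Submodule.smul_mem _ _ (hmem _))

/-- Carathéodory puts `x` in a simplex with affinely independent vertices; choosing one index per
vertex and extending to a basis gives the `dirs` of a supported tile, of arbitrary order. -/
lemma exists_supported_isHeightCell (ha : affineSpan ℝ (Set.range a) = ⊤)
    (hg : NoExtraContact (fun i => projLift (a i)) h) (hx : x ∈ convexHull ℝ (Set.range a)) :
    ∃ T c, IsHeightCell (fun i => projLift (a i)) h T c ∧ T.SupportedOn a x := by
  classical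
  rw [convexHull_eq_union] at hx
  simp only [Set.mem_iUnion] at hx
  obtain ⟨t, hta, hti, hxt⟩ := hx
  obtain ⟨J, -, hJ⟩ := Set.SurjOn.exists_bijOn_subset (f := a) (s := Set.univ) (t := (t : Set _))
    (by rwa [Set.SurjOn, Set.image_univ])
  have hJi : LinearIndepOn ℝ (fun i => projLift (a i)) J := by
    have h1 := (affineIndependent_iff_linearIndependent_projLift _).1 hti
    have h2 : LinearIndepOn ℝ (fun p : Fin d → ℝ => projLift p) (a '' J) := by
      rw [hJ.image_eq]; exact h1
    exact h2.comp_of_image hJ.injOn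
  obtain ⟨B, -, hJB, hsp, hB⟩ := exists_linearIndepOn_extension hJi (Set.subset_univ J)
  have hcard : B.toFinset.card = d + 1 := by
    have htop : ⊤ ≤ Submodule.span ℝ (Set.range fun b : B => projLift (a b)) := by
      rw [← span_range_projLift_eq_top ha, Submodule.span_le, ← Set.image_univ]
      refine hsp.trans (le_of_eq ?_)
      rw [Set.image_eq_range]
    have := Module.finrank_eq_card_basis (Module.Basis.mk hB htop)
    rw [Set.toFinset_card, ← this]
    simp
  obtain ⟨T, c, hT, hTB⟩ := exists_isHeightCell hg hcard (by simpa using hB)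
  refine ⟨T, c, hT, ?_⟩
  rw [← hJ.image_eq] at hxt
  refine convexHull_mono (Set.image_mono (hJB.trans ?_)) hxt
  intro i hi
  simp [hTB, hi]

lemma eq_of_order_zero (hg : NoExtraContact (fun i => projLift (a i)) h)
    (hxg : IsGenericForTiling a (regularTiling a h) x) {T T' : Cell n} {c c' : Fin (d + 1) → ℝ}
    (hT : IsHeightCell (fun i => projLift (a i)) h T c)
    (hT' : IsHeightCell (fun i => projLift (a i)) h T' c') (h0 : T.order = 0) (h0' : T'.order = 0)
    (hs : T.SupportedOn a x) (hs' : T'.SupportedOn a x) : T = T' := by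
  have rep : ∀ {T : Cell n}, T.order = 0 → T.SupportedOn a x →
      ∃ μ : Fin n → ℝ, (∀ i, 0 ≤ μ i) ∧ ∑ b ∈ T.dirs, μ b • projLift (a b) = projLift x := by
    intro T h0 hs
    rw [Cell.SupportedOn, Finset.card_eq_zero.1 h0, Finset.empty_union] at hs
    obtain ⟨μ, h1, h2, h3⟩ := (mem_convexHull_image_iff _ _ _).1 hs
    exact ⟨μ, h1, by
      rw [← h3, Finset.sum_subset (Finset.subset_univ _) fun i _ hi => by simp [h2 i hi]]⟩
  have above : ∀ {T : Cell n} {c}, T.order = 0 → IsHeightCell (fun i => projLift (a i)) h T c →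
      ∀ i, i ∉ T.dirs → h i < c ⬝ᵥ projLift (a i) := fun h0 hT i hi =>
    hT.off i (by simp [Finset.card_eq_zero.1 h0]) hi
  have diff : ∀ {T : Cell n} {c} (e : Fin (d + 1) → ℝ) {μ : Fin n → ℝ},
      IsHeightCell (fun i => projLift (a i)) h T c →
      ∑ b ∈ T.dirs, μ b • projLift (a b) = projLift x →
      e ⬝ᵥ projLift x - c ⬝ᵥ projLift x = ∑ b ∈ T.dirs, μ b * (e ⬝ᵥ projLift (a b) - h b) := by
    intro T c e μ hT hμ
    rw [← sub_dotProduct, ← hμ, dotProduct_sum]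
    refine Finset.sum_congr rfl fun b hb => ?_
    rw [dotProduct_smul, sub_dotProduct, hT.on_dirs b hb, smul_eq_mul]
  have weak : ∀ {T : Cell n} {c}, T.order = 0 → IsHeightCell (fun i => projLift (a i)) h T c →
      ∀ i, 0 ≤ c ⬝ᵥ projLift (a i) - h i := by
    intro T c h0 hT i
    by_cases hi : i ∈ T.dirs
    · exact (sub_eq_zero.2 (hT.on_dirs i hi)).ge
    · exact (sub_pos.2 (above h0 hT i hi)).le
  obtain ⟨μ, hμ, hμx⟩ := rep h0 hs
  obtain ⟨μ', hμ', hμx'⟩ := rep h0' hs'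
  have hd := diff c' hT hμx
  have hd' := diff c hT' hμx'
  have hn : ∀ b ∈ T.dirs, 0 ≤ μ b * (c' ⬝ᵥ projLift (a b) - h b) := fun b _ =>
    mul_nonneg (hμ b) (weak h0' hT' b)
  have hn' : 0 ≤ ∑ b ∈ T'.dirs, μ' b * (c ⬝ᵥ projLift (a b) - h b) :=
    Finset.sum_nonneg fun b _ => mul_nonneg (hμ' b) (weak h0 hT b)
  -- The differences in `hd` and `hd'` are opposite and both nonnegative, so they vanish. Hence `μ`
  -- vanishes at each index of `T.dirs` where `c'` lies strictly above the height.
  have hzero := (Finset.sum_eq_zero_iff_of_nonneg hn).1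
    (le_antisymm (by linarith) (Finset.sum_nonneg hn))
  refine hT.eq_of_dirs_eq hT' (Finset.eq_of_subset_of_card_le (fun b hb => ?_)
    (by rw [hT.card, hT'.card]))
  by_contra hb'
  have hμb : μ b = 0 :=
    (mul_eq_zero.1 (hzero b hb)).resolve_right (sub_pos.2 (above h0' hT' b hb')).ne'
  obtain ⟨N, hNb, hN⟩ := exists_dual hT.card hT.indep hb
  have hNx : N ⬝ᵥ projLift x = 0 := by
    rw [← hμx, dotProduct_sum_smul_of_dual hb hN, hμb, zero_mul]
  -- The coordinate of `x` at `b` is zero, so by genericity `N` kills every vector except that of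
  -- `b`; since `b ∉ T'.dirs`, it kills a whole basis.
  have hN0 : N = 0 := eq_of_dotProduct_eq_on hT'.card hT'.indep fun i hi => by
    rw [zero_dotProduct]
    exact hT.dual_eq_zero hg hxg hb hN (by simp [hNb]) hNx (by rintro rfl; exact hb' hi)
  simp [hN0] at hNb

end OrderZero

end

theorem proposition5 {n d : ℕ} (a : Fin n → Fin d → ℝ)
    (ha : affineSpan ℝ (Set.range a) = ⊤)
    (h : Fin n → ℝ) (hh : IsGenericHeight a h)
    (x : Fin d → ℝ) (hx : x ∈ convexHull ℝ (Set.range a))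
    (hxg : IsGenericForTiling a (regularTiling a h) x) :
    (∃! T₀ : Cell n, T₀ ∈ regularTiling a h ∧ T₀.order = 0 ∧ T₀.SupportedOn a x) ∧
    ∀ T₀ : Cell n, T₀ ∈ regularTiling a h → T₀.order = 0 → T₀.SupportedOn a x →
      ∀ T' : Cell n, T' ∈ regularTiling a h → T'.SupportedOn a x →
        ∃ p : List (Cell n),
          IsDirectedPath (orientedAdjacencyGraph a (regularTiling a h) x) T₀ T' p ∧
          ∀ T ∈ p, T ∈ regularTiling a h ∧ T.SupportedOn a x ∧ T.order ≤ T'.order := by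
  have hg := hh.noExtraContact
  have huniq : ∀ T T' : Cell n, (T ∈ regularTiling a h ∧ T.order = 0 ∧ T.SupportedOn a x) →
      (T' ∈ regularTiling a h ∧ T'.order = 0 ∧ T'.SupportedOn a x) → T = T' := by
    rintro T T' ⟨hT, h0, hs⟩ ⟨hT', h0', hs'⟩
    obtain ⟨c, hc⟩ := exists_isHeightCell_of_mem_regularTiling hg hT
    obtain ⟨c', hc'⟩ := exists_isHeightCell_of_mem_regularTiling hg hT'
    exact eq_of_order_zero hg hxg hc hc' h0 h0' hs hs'
  refine ⟨?_, fun T₀ hT₀ h0 hs₀ T' hT' hs' => ?_⟩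
  -- Any supported tile suffices: the start of a path leading to it is a supported tile of order
  -- `0`.
  · obtain ⟨T, c, hT, hs⟩ := exists_supported_isHeightCell ha hg hx
    obtain ⟨T₀, -, hT₀, -⟩ :=
      exists_directedPath_from_order_zero hg hxg T hT.mem_regularTiling hs
    exact ⟨T₀, hT₀, fun T₁ hT₁ => huniq T₁ T₀ hT₁ hT₀⟩
  · obtain ⟨T₁, p, hT₁, hp, hall⟩ := exists_directedPath_from_order_zero hg hxg T' hT' hs'
    obtain rfl := huniq T₀ T₁ ⟨hT₀, h0, hs₀⟩ hT₁
    exact ⟨p, hp, fun T hT => (hall T hT).1⟩
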